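/- Lemma 1.2. Let $(B_t)_{t\ge 0}$ be a standard three-dimensional Brownian motion with $B_0=0$, let $V:\mathbb{R}^3\to\mathbb{R}$ be continuous, and for each $R>0$ let $\omega_R:[0,\infty)\to[0,1]$ be an infinitely smooth function with $\omega_R(r)=1$ for $r<R-1$ and $\omega_R(r)=0$ for $r>R+1$. For $\rho>0$ put $V^{(\rho)}(x)=V(x)\,(1-\omega_\rho(|x|))$. Let $\theta\in\mathbb{R}^3$ with $|\theta|=1$, and let $G_t=t\theta+B_t$ be the solution of $dG_t=\theta\,dt+dB_t$, $G_0=0$. If $$\mathbb{E}\left[\exp\left(-\frac12\int_0^\infty |V(G_t)|\,dt\right)\right]>0,$$ then $$\lim_{\rho\to\infty}\mathbb{E}\left[\exp\left(-\frac12\int_0^\infty |V^{(\rho)}(G_t)|\,dt\right)\right]=1,$$ where the exponential is taken to be $0$ when the integral is infinite. -/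

import Mathlib

open MeasureTheory ProbabilityTheory Filter Topology
open scoped NNReal ENNReal ContDiff

noncomputable section

/-- Three-dimensional Euclidean space. -/
abbrev E3 : Type := EuclideanSpace ℝ (Fin 3)

/-- `B` is a standard three-dimensional Brownian motion started at the origin: a family of random
variables whose three coordinate processes are independent real Brownian motions. -/
structure IsBrownianMotion3 {Ω : Type*} [MeasurableSpace Ω] (B : ℝ≥0 → Ω → E3)
    (P : Measure Ω) : Prop where
  measurable : ∀ t, Measurable (B t)
  coord : ∀ i : Fin 3, IsBrownianReal (fun t w => B t w i) P
  indep : iIndepFun (fun (i : Fin 3) (w : Ω) (t : ℝ≥0) => B t w i) P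

/-- The solution `G_t = t θ + B_t` of `dG_t = θ dt + dB_t`, `G_0 = 0`. -/
def driftedPath {Ω : Type*} (θ : E3) (B : ℝ≥0 → Ω → E3) (t : ℝ≥0) (w : Ω) : E3 :=
  (t : ℝ) • θ + B t w

/-- `χ` is a smooth cutoff on `[0, ∞)` with values in `[0, 1]`, equal to `1` for `r < R - 1` and
to `0` for `r > R + 1`. -/
structure IsRadialCutoff (R : ℝ) (χ : ℝ → ℝ) : Prop where
  smooth : ContDiffOn ℝ ∞ χ (Set.Ici 0)
  eq_one : ∀ r, 0 ≤ r → r < R - 1 → χ r = 1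
  eq_zero : ∀ r, 0 ≤ r → R + 1 < r → χ r = 0
  mem_Icc : ∀ r, 0 ≤ r → χ r ∈ Set.Icc (0 : ℝ) 1

/-- The truncated potential `V(x) (1 - χ(|x|))`. -/
def tailPotential (V : E3 → ℝ) (χ : ℝ → ℝ) (x : E3) : ℝ := V x * (1 - χ ‖x‖)

/-- The integral `∫_0^∞ |V(G_t(w))| dt ∈ [0, ∞]` along a path. -/
def pathIntegral {Ω : Type*} (V : E3 → ℝ) (G : ℝ≥0 → Ω → E3) (w : Ω) : ℝ≥0∞ :=
  ∫⁻ t in Set.Ioi (0 : ℝ), ENNReal.ofReal |V (G t.toNNReal w)|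

/-- The expectation `E[exp(-½ ∫_0^∞ |V(G_t)| dt)]`, as the integral of a `[0, 1]`-valued random
variable, with `exp(-∞) = 0`. -/
def expectedDamping {Ω : Type*} [MeasurableSpace Ω] (V : E3 → ℝ) (G : ℝ≥0 → Ω → E3)
    (P : Measure Ω) : ℝ≥0∞ :=
  ∫⁻ w, EReal.exp (-((pathIntegral V G w / 2 : ℝ≥0∞) : EReal)) ∂P

end

/-!
# Truncated potentials along a drifted Brownian path

Let `I = ∫_0^∞ |V(G_t)| dt`. If `I` is finite almost surely, then dominated convergence along each
path shows that the truncated integrals tend to `0` (`tendsto_pathIntegral_tailPotential`), and a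
second dominated convergence shows that the expectations of the damping factors tend to `1`. The
hypothesis says only that `I` is finite with positive probability, so what is needed is a zero-one
law. Paths are continuous and `V` is continuous, so `∫_0^T |V(G_t)| dt` is always finite and
`{I < ∞}` belongs to the tail σ-algebra of `B` (`measurableSet_tail_pathIntegral_lt_top`); the drift
is deterministic and does not affect the tail.

The tail σ-algebra of Brownian motion is trivial for the following reason. The bridge
`B_t - (t / T) B_T`, `t ≤ T`, is uncorrelated with, hence independent of, `(B_s)_{s ≥ T}`
(`IsBrownianMotion3.indepFun_bridge_future`). A tail event is therefore independent of all these
bridges, and since `B_T / T → 0` almost surely along `T = 2 ^ n`, it is independent of `B` itself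
(`IsBrownianMotion3.indep_tail`), in particular of itself.
-/

/-! ### Path integrals and truncated potentials -/

section Path

variable {Ω : Type*} {B : ℝ≥0 → Ω → E3}

lemma pathIntegral_congr {C : ℝ≥0 → Ω → E3} (V : E3 → ℝ) (θ : E3) {w : Ω}
    (h : ∀ t, B t w = C t w) :
    pathIntegral V (driftedPath θ B) w = pathIntegral V (driftedPath θ C) w := by
  simp only [pathIntegral, driftedPath, h]

/-- The integral over `(T, ∞)` along the drifted path is measurable with respect to any σ-algebra
that makes `B t` measurable for all `t ≥ T`. -/
lemma measurable_lintegral_Ioi {m : MeasurableSpace Ω} {V : E3 → ℝ} (hV : Continuous V) (θ : E3)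
    (hc : ∀ w, Continuous fun t => B t w) (T : ℝ≥0) (hm : ∀ t, T ≤ t → Measurable[m] (B t)) :
    Measurable[m] fun w =>
      ∫⁻ t in Set.Ioi (T : ℝ), ENNReal.ofReal |V (driftedPath θ B t.toNNReal w)| := by
  -- Freezing the path before time `T` changes nothing on `(T, ∞)` and keeps the integrand
  -- measurable for every real `t`.
  have hu : Measurable (Function.uncurry fun (t : ℝ) (w : Ω) =>
      ENNReal.ofReal |V (driftedPath θ B (max T t.toNNReal) w)|) := by
    refine measurable_uncurry_of_continuous_of_measurable (fun w => ?_) fun t => ?_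
    · have := hc w
      refine ENNReal.continuous_ofReal.comp ?_
      unfold driftedPath
      fun_prop
    · have := hm (max T t.toNNReal) (le_max_left _ _)
      have := hV.measurable
      unfold driftedPath
      fun_prop
  have heq (w : Ω) :
      ∫⁻ t in Set.Ioi (T : ℝ), ENNReal.ofReal |V (driftedPath θ B t.toNNReal w)| =
      ∫⁻ t in Set.Ioi (T : ℝ), ENNReal.ofReal |V (driftedPath θ B (max T t.toNNReal) w)| := by
    refine setLIntegral_congr_fun measurableSet_Ioi fun t ht => ?_
    rw [max_eq_right (NNReal.le_toNNReal_of_coe_le (le_of_lt ht))]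
  simp_rw [heq]
  exact hu.lintegral_prod_left'

/-- Finiteness of the path integral depends only on the path after time `T`, since a continuous
integrand has finite integral over `(0, T]`. -/
lemma pathIntegral_lt_top_iff {V : E3 → ℝ} (hV : Continuous V) (θ : E3) {w : Ω}
    (hc : Continuous fun t => B t w) (T : ℝ≥0) :
    pathIntegral V (driftedPath θ B) w < ⊤ ↔
      ∫⁻ t in Set.Ioi (T : ℝ), ENNReal.ofReal |V (driftedPath θ B t.toNNReal w)| < ⊤ := by
  have hcont : Continuous fun t : ℝ => |V (driftedPath θ B t.toNNReal w)| := by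
    unfold driftedPath
    fun_prop
  have hfin : ∫⁻ t in Set.Ioc 0 (T : ℝ), ENNReal.ofReal |V (driftedPath θ B t.toNNReal w)| < ⊤ := by
    have hi : IntegrableOn (fun t : ℝ => |V (driftedPath θ B t.toNNReal w)|) (Set.Ioc 0 (T : ℝ)) :=
      hcont.integrableOn_Ioc
    exact hi.lintegral_lt_top
  rw [pathIntegral, ← Set.Ioc_union_Ioi_eq_Ioi T.2,
    lintegral_union measurableSet_Ioi (Set.Ioc_disjoint_Ioi le_rfl), ENNReal.add_lt_top]
  exact and_iff_right hfin

lemma continuous_exp_neg_half : Continuous fun x : ℝ≥0∞ => EReal.exp (-((x / 2 : ℝ≥0∞) : EReal)) :=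
  ENNReal.continuous_exp.comp <| continuous_neg.comp <| continuous_coe_ennreal_ereal.comp <|
    ENNReal.continuous_div_const 2 (by norm_num)

lemma continuous_tailPotential {V : E3 → ℝ} (hV : Continuous V) {R : ℝ} {χ : ℝ → ℝ}
    (hχ : IsRadialCutoff R χ) : Continuous (tailPotential V χ) := by
  have : Continuous fun x : E3 => χ ‖x‖ :=
    hχ.smooth.continuousOn.comp_continuous continuous_norm fun x => norm_nonneg x
  exact hV.mul (continuous_const.sub this)

lemma abs_tailPotential_le {V : E3 → ℝ} {R : ℝ} {χ : ℝ → ℝ}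
    (hχ : IsRadialCutoff R χ) (x : E3) : |tailPotential V χ x| ≤ |V x| := by
  obtain ⟨h0, h1⟩ := hχ.mem_Icc ‖x‖ (norm_nonneg x)
  rw [tailPotential, abs_mul]
  exact mul_le_of_le_one_right (abs_nonneg _) (abs_le.2 ⟨by linarith, by linarith⟩)

/-- If the path integral of `|V|` is finite, the truncated ones tend to `0` by dominated convergence:
at each fixed time the truncated potential vanishes once `ρ > |G_t| + 1`. -/
lemma tendsto_pathIntegral_tailPotential {V : E3 → ℝ} (hV : Continuous V)
    {χ : ℝ → ℝ → ℝ} (hχ : ∀ R : ℝ, 0 < R → IsRadialCutoff R (χ R)) (θ : E3) {w : Ω}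
    (hc : Continuous fun t => B t w) (hfin : pathIntegral V (driftedPath θ B) w < ⊤) :
    Tendsto (fun ρ => pathIntegral (tailPotential V (χ ρ)) (driftedPath θ B) w) atTop (𝓝 0) := by
  have hpath : Continuous fun t : ℝ => driftedPath θ B t.toNNReal w := by
    unfold driftedPath
    fun_prop
  rw [← lintegral_zero (μ := volume.restrict (Set.Ioi (0 : ℝ)))]
  refine tendsto_lintegral_filter_of_dominated_convergence
    (fun t => ENNReal.ofReal |V (driftedPath θ B t.toNNReal w)|) ?_ ?_ hfin.ne ?_
  · filter_upwards [eventually_gt_atTop 0] with ρ hρ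
    exact (((continuous_tailPotential hV (hχ ρ hρ)).comp hpath).abs.measurable).ennreal_ofReal
  · filter_upwards [eventually_gt_atTop 0] with ρ hρ
    exact ae_of_all _ fun t => ENNReal.ofReal_le_ofReal (abs_tailPotential_le (hχ ρ hρ) _)
  · refine ae_of_all _ fun t => tendsto_const_nhds.congr' ?_
    filter_upwards [eventually_gt_atTop 0,
      eventually_gt_atTop (‖driftedPath θ B t.toNNReal w‖ + 1)] with ρ hρ hρ'
    rw [tailPotential, (hχ ρ hρ).eq_one _ (norm_nonneg _) (by linarith)]
    simp

/-! ### The tail σ-algebra -/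

/-- The tail σ-algebra `⋂_T σ(B s : s ≥ T)` of `B`, generated by the coordinates of `B s`. -/
@[reducible] def brownianTail (B : ℝ≥0 → Ω → E3) : MeasurableSpace Ω :=
  ⨅ T : ℝ≥0, MeasurableSpace.comap
    (fun w (q : {q : ℝ≥0 × Fin 3 // T ≤ q.1}) => B q.1.1 w q.1.2) inferInstance

/-- Finiteness of the path integral of a continuous potential along continuous paths is a tail
event. -/
lemma measurableSet_tail_pathIntegral_lt_top {V : E3 → ℝ} (hV : Continuous V) (θ : E3)
    (hc : ∀ w, Continuous fun t => B t w) :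
    MeasurableSet[brownianTail B] {w | pathIntegral V (driftedPath θ B) w < ⊤} := by
  rw [brownianTail, MeasurableSpace.measurableSet_iInf]
  intro T
  simp_rw [pathIntegral_lt_top_iff hV θ (hc _) T]
  refine measurableSet_Iio.preimage (measurable_lintegral_Ioi hV θ hc T fun t ht => ?_)
  have hpi : Measurable[MeasurableSpace.comap
      (fun w (q : {q : ℝ≥0 × Fin 3 // T ≤ q.1}) => B q.1.1 w q.1.2) inferInstance]
      fun w (i : Fin 3) => B t w i :=
    (measurable_pi_lambda (fun (x : {q : ℝ≥0 × Fin 3 // T ≤ q.1} → ℝ) (i : Fin 3) => x ⟨(t, i), ht⟩)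
      fun i => measurable_pi_apply _).comp (comap_measurable _)
  exact (MeasurableEquiv.toLp 2 (Fin 3 → ℝ)).measurable.comp hpi

end Path

section Brownian

variable {Ω : Type*} [MeasurableSpace Ω] {P : Measure Ω} {B : ℝ≥0 → Ω → E3}

/-! ### The zero-one law for Brownian motion -/

/-- The three coordinate processes, indexed jointly by time and coordinate, form one Gaussian
process, so that independence can be read off from covariances. -/
lemma IsBrownianMotion3.isGaussianProcess (hB : IsBrownianMotion3 B P) :
    IsGaussianProcess (fun (p : ℝ≥0 × Fin 3) w => B p.1 w p.2) P where
  hasGaussianLaw I := by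
    classical
    let J : Finset ℝ≥0 := I.image Prod.fst
    have hind : iIndepFun (fun (i : Fin 3) (w : Ω) (t : J) => B t w i) P :=
      hB.indep.comp (fun _ (x : ℝ≥0 → ℝ) (t : J) => x t) (fun _ => by fun_prop)
    have hJ : HasGaussianLaw (fun w (i : Fin 3) (t : J) => B t w i) P :=
      iIndepFun.hasGaussianLaw
        (fun i => (IsPreBrownianReal.isGaussianProcess (hB.coord i).1).hasGaussianLaw J) hind
    let L : (Fin 3 → J → ℝ) →L[ℝ] (I → ℝ) :=
      { toFun x p := x p.1.2 ⟨p.1.1, Finset.mem_image_of_mem _ p.2⟩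
        map_add' x y := by ext; simp
        map_smul' c x := by ext; simp }
    exact hJ.map L

lemma IsBrownianMotion3.memLp_two (hB : IsBrownianMotion3 B P) (t : ℝ≥0) (i : Fin 3) :
    MemLp (fun w => B t w i) 2 P :=
  (hB.isGaussianProcess.hasGaussianLaw_eval (t, i)).memLp_two

lemma IsBrownianMotion3.covariance_eq (hB : IsBrownianMotion3 B P) (s t : ℝ≥0) (i j : Fin 3) :
    cov[fun w => B s w i, fun w => B t w j; P] = if i = j then ((min s t : ℝ≥0) : ℝ) else 0 := by
  split_ifs with h
  · subst h
    exact (hB.coord i).covariance_fun_eval s t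
  · exact ((hB.indep.indepFun h).comp (measurable_pi_apply s)
      (measurable_pi_apply t)).covariance_eq_zero (hB.memLp_two s i) (hB.memLp_two t j)

/-- The Brownian bridge `B t - (t / T) B T` on `[0, T]` is independent of `(B s)_{s ≥ T}`, because
`t - (t / T) T = 0` makes the two uncorrelated. -/
lemma IsBrownianMotion3.indepFun_bridge_future (hB : IsBrownianMotion3 B P) {T : ℝ≥0}
    (hT : T ≠ 0) :
    IndepFun
      (fun w (p : {p : ℝ≥0 × Fin 3 // p.1 ≤ T}) =>
        B p.1.1 w p.1.2 - (p.1.1 / T : ℝ) * B T w p.1.2)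
      (fun w (q : {q : ℝ≥0 × Fin 3 // T ≤ q.1}) => B q.1.1 w q.1.2) P := by
  classical
  have := hB.isGaussianProcess.isProbabilityMeasure
  have hm : ∀ t i, Measurable fun w => B t w i := fun t i =>
    (by fun_prop : Measurable fun x : E3 => x i).comp (hB.measurable t)
  apply IsGaussianProcess.indepFun_of_covariance_eq_zero
  · apply hB.isGaussianProcess.of_isGaussianProcess
    rintro (⟨⟨t, i⟩, -⟩ | ⟨⟨t, i⟩, -⟩)
    · exact ⟨{(T, i), (t, i)},
        { toFun x := x ⟨(t, i), by simp⟩ - (t / T : ℝ) * x ⟨(T, i), by simp⟩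
          map_add' x y := by simp; ring
          map_smul' c x := by simp; ring }, by simp⟩
    · exact ⟨{(t, i)},
        { toFun x := x ⟨(t, i), by simp⟩
          map_add' x y := by simp
          map_smul' c x := by simp }, by simp⟩
  · rintro ⟨⟨t, i⟩, -⟩
    exact ((hm t i).sub ((hm T i).const_mul _)).aemeasurable
  · rintro ⟨⟨t, i⟩, -⟩
    exact (hm t i).aemeasurable
  · rintro ⟨⟨t, i⟩, ht⟩ ⟨⟨s, j⟩, hs⟩
    have ht : t ≤ T := ht
    have hs : T ≤ s := hs
    rw [covariance_fun_sub_left (hB.memLp_two t i) ((hB.memLp_two T i).const_mul _)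
      (hB.memLp_two s j), covariance_const_mul_left, hB.covariance_eq, hB.covariance_eq,
      min_eq_left hs, min_eq_left (ht.trans hs)]
    have : (T : ℝ) ≠ 0 := by exact_mod_cast hT
    split_ifs
    · field_simp; ring
    · simp

/-- Along the times `2 ^ n` the second moments of `B t / t` are `2 ^ (-n)`, hence summable, which
gives almost sure convergence to `0`. -/
lemma IsBrownianMotion3.tendsto_div_two_pow (hB : IsBrownianMotion3 B P) :
    ∀ᵐ w ∂P, ∀ i, Tendsto (fun n : ℕ => B (2 ^ n) w i / 2 ^ n) atTop (𝓝 0) := by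
  refine ae_all_iff.2 fun i => ?_
  have := hB.isGaussianProcess.isProbabilityMeasure
  have hm : ∀ t, Measurable fun w => B t w i := fun t =>
    (by fun_prop : Measurable fun x : E3 => x i).comp (hB.measurable t)
  have h2 (n : ℕ) : ∫⁻ w, ENNReal.ofReal ((B (2 ^ n) w i / 2 ^ n) ^ 2) ∂P
      = ENNReal.ofReal ((1 / 2) ^ n) := by
    have hmem : MemLp (fun w => B (2 ^ n) w i / 2 ^ n) 2 P :=
      by simpa only [div_eq_mul_inv] using (hB.memLp_two (2 ^ n) i).mul_const _
    rw [← ofReal_integral_eq_lintegral_ofReal hmem.integrable_sq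
      (ae_of_all _ fun w => sq_nonneg _)]
    congr 1
    have hv := covariance_self (hm (2 ^ n)).aemeasurable (μ := P)
    rw [hB.covariance_eq, variance_eq_sub (hB.memLp_two _ i)] at hv
    have h0 : ∫ w, B (2 ^ n) w i ∂P = 0 := (hB.coord i).integral_eval _
    simp only [if_true, min_self, h0, Pi.pow_apply] at hv
    simp only [div_pow, integral_div]
    rw [show (∫ w, B (2 ^ n) w i ^ 2 ∂P) = 2 ^ n by simpa using hv.symm]
    simp [sq]
  have hsum : ∫⁻ w, ∑' n : ℕ, ENNReal.ofReal ((B (2 ^ n) w i / 2 ^ n) ^ 2) ∂P ≠ ⊤ := by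
    rw [lintegral_tsum fun n => by
      exact (((hm _).div_const _).pow_const 2).ennreal_ofReal.aemeasurable]
    simp_rw [h2]
    exact (summable_geometric_two).tsum_ofReal_ne_top
  filter_upwards [ae_lt_top' (Measurable.aemeasurable (Measurable.tsum fun n =>
    (((hm (2 ^ n)).div_const (2 ^ n)).pow_const 2).ennreal_ofReal)) hsum]
    with w hw
  have h := ENNReal.tendsto_atTop_zero_of_tsum_ne_top hw.ne
  have h' := (ENNReal.tendsto_toReal ENNReal.zero_ne_top).comp h
  simp only [Function.comp_def, ENNReal.toReal_ofReal (sq_nonneg _), ENNReal.toReal_zero] at h'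
  rw [tendsto_zero_iff_abs_tendsto_zero]
  simpa [Real.sqrt_sq_eq_abs, Function.comp_def] using h'.sqrt

lemma setIntegral_comp_eq_of_indepFun {α β : Type*} [MeasurableSpace α] [MeasurableSpace β]
    {X : Ω → α} {Y : Ω → β} (h : IndepFun X Y P) (hX : Measurable X) (hY : Measurable Y)
    {f : α → ℝ} (hf : Measurable f)
    {A : Set Ω} (hA : MeasurableSet[MeasurableSpace.comap Y inferInstance] A) :
    ∫ w in A, f (X w) ∂P = P.real A * ∫ w, f (X w) ∂P := by
  obtain ⟨S, hS, rfl⟩ := hA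
  have hi : Measurable (S.indicator (1 : β → ℝ)) := measurable_one.indicator hS
  have := (h.comp hf hi).integral_fun_mul_eq_mul_integral
    (hf.comp hX).aestronglyMeasurable (hi.comp hY).aestronglyMeasurable
  rw [mul_comm, ← integral_indicator (hY hS)]
  convert this using 1
  · refine integral_congr_ae (ae_of_all _ fun w => ?_)
    by_cases hw : Y w ∈ S <;> simp [hw, Set.indicator]
  · congr 1
    rw [show (S.indicator (1 : β → ℝ)) ∘ Y = (Y ⁻¹' S).indicator 1 from rfl,
      integral_indicator_one (hY hS)]

/-- The tail σ-algebra is independent of the whole process: a tail event is independent of the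
bridges on `[0, 2 ^ n]`, which converge almost surely to `B`. -/
lemma IsBrownianMotion3.indep_tail (hB : IsBrownianMotion3 B P) :
    Indep (brownianTail B)
      (MeasurableSpace.comap (fun w (p : ℝ≥0 × Fin 3) => B p.1 w p.2) inferInstance) P := by
  have := hB.isGaussianProcess.isProbabilityMeasure
  have hm : ∀ t i, Measurable fun w => B t w i := fun t i =>
    (by fun_prop : Measurable fun x : E3 => x i).comp (hB.measurable t)
  have hle (T : ℝ≥0) : MeasurableSpace.comap
      (fun w (q : {q : ℝ≥0 × Fin 3 // T ≤ q.1}) => B q.1.1 w q.1.2) inferInstance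
      ≤ ‹MeasurableSpace Ω› :=
    (measurable_pi_lambda _ fun q : {q : ℝ≥0 × Fin 3 // T ≤ q.1} => hm q.1.1 q.1.2).comap_le
  refine indep_comap_process_of_bcf ((iInf_le _ 0).trans (hle 0))
    (fun p => (hm p.1 p.2).aemeasurable) fun A hA I f => ?_
  have hA' (T : ℝ≥0) := (iInf_le _ T : brownianTail B ≤ _) A hA
  -- `Z n` is the bridge on `[0, 2 ^ n]`, sampled at the times in `I`.
  let Z (n : ℕ) (w : Ω) (p : I) : ℝ :=
    B p.1.1 w p.1.2 - (p.1.1 / (2 ^ n : ℝ≥0) : ℝ) * B (2 ^ n) w p.1.2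
  have hZm (n : ℕ) : Measurable (Z n) :=
    measurable_pi_lambda _ fun p => (hm _ _).sub ((hm _ _).const_mul _)
  have hZ : ∀ᵐ w ∂P, Tendsto (fun n => f (Z n w)) atTop (𝓝 (f fun p : I => B p.1.1 w p.1.2)) := by
    filter_upwards [hB.tendsto_div_two_pow] with w hw
    refine (f.continuous.tendsto _).comp (tendsto_pi_nhds.2 fun p => ?_)
    have := ((hw p.1.2).const_mul (p.1.1 : ℝ)).const_sub (B p.1.1 w p.1.2)
    rw [mul_zero, sub_zero] at this
    refine this.congr fun n => ?_
    simp only [Z]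
    push_cast
    ring
  have heq : ∀ᶠ n in atTop, ∫ w in A, f (Z n w) ∂P = P.real A * ∫ w, f (Z n w) ∂P := by
    have : ∀ᶠ n : ℕ in atTop, ∀ p : I, p.1.1 ≤ (2 : ℝ≥0) ^ n :=
      eventually_all.2 fun p =>
        (tendsto_pow_atTop_atTop_of_one_lt (by norm_num : (1 : ℝ≥0) < 2)).eventually_ge_atTop _
    filter_upwards [this] with n hn
    have hi := (hB.indepFun_bridge_future (T := 2 ^ n) (by positivity)).comp
      (φ := fun x (p : I) => x ⟨p.1, hn p⟩) (by fun_prop) measurable_id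
    exact setIntegral_comp_eq_of_indepFun hi (hZm n)
      (measurable_pi_lambda _ fun q : {q : ℝ≥0 × Fin 3 // 2 ^ n ≤ q.1} => hm q.1.1 q.1.2)
      f.continuous.measurable (hA' _)
  have hlim (μ : Measure Ω) [IsFiniteMeasure μ] (hμ : μ ≪ P) :
      Tendsto (fun n => ∫ w, f (Z n w) ∂μ) atTop (𝓝 (∫ w, f (fun p : I => B p.1.1 w p.1.2) ∂μ)) :=
    tendsto_integral_of_dominated_convergence (fun _ => ‖f‖)
      (fun n => (f.continuous.measurable.comp (hZm n)).aestronglyMeasurable)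
      (integrable_const _) (fun n => ae_of_all _ fun w => f.norm_coe_le_norm _) (hμ.ae_le hZ)
  exact tendsto_nhds_unique_of_eventuallyEq
    (hlim (P.restrict A) Measure.restrict_le_self.absolutelyContinuous)
    ((hlim P .rfl).const_mul _) heq

/-- Zero-one law for tail events of Brownian motion. -/
lemma IsBrownianMotion3.measure_eq_zero_or_one_of_tail (hB : IsBrownianMotion3 B P) {A : Set Ω}
    (hA : MeasurableSet[brownianTail B] A) : P A = 0 ∨ P A = 1 := by
  have := hB.isGaussianProcess.isProbabilityMeasure
  refine measure_eq_zero_or_one_of_indep_self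
    (indep_of_indep_of_le_right hB.indep_tail ((iInf_le _ 0).trans ?_)) hA
  rintro _ ⟨S, hS, rfl⟩
  exact ⟨(fun x (q : {q : ℝ≥0 × Fin 3 // 0 ≤ q.1}) => x q.1) ⁻¹' S,
    (measurable_pi_lambda _ fun q => measurable_pi_apply _) hS, rfl⟩

/-! ### Continuous versions -/

lemma IsBrownianMotion3.ae_continuous (hB : IsBrownianMotion3 B P) :
    ∀ᵐ w ∂P, Continuous fun t => B t w := by
  filter_upwards [ae_all_iff.2 fun i => (hB.coord i).cont] with w hw
  exact (PiLp.continuous_toLp 2 _).comp (continuous_pi hw)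

lemma IsBrownianMotion3.congr {C : ℝ≥0 → Ω → E3} (hB : IsBrownianMotion3 B P)
    (hC : ∀ t, Measurable (C t)) (h : ∀ᵐ w ∂P, ∀ t, B t w = C t w) : IsBrownianMotion3 C P where
  measurable := hC
  coord i :=
    { toIsPreBrownianReal := (hB.coord i).toIsPreBrownianReal.congr fun t => by
        filter_upwards [h] with w hw using by rw [hw]
      cont := by
        filter_upwards [h, (hB.coord i).cont] with w hw hc using by simpa only [hw] using hc }
  indep := hB.indep.congr fun i => by
    filter_upwards [h] with w hw using by simp only [hw]

/-- Replacing the exceptional paths by the zero path gives a Brownian motion all of whose paths are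
continuous. -/
lemma IsBrownianMotion3.exists_continuous_version (hB : IsBrownianMotion3 B P) :
    ∃ C : ℝ≥0 → Ω → E3, IsBrownianMotion3 C P ∧ (∀ w, Continuous fun t => C t w) ∧
      ∀ᵐ w ∂P, ∀ t, B t w = C t w := by
  classical
  obtain ⟨N, hN, hNm, hN0⟩ := exists_measurable_superset_of_null hB.ae_continuous
  have hae : ∀ᵐ w ∂P, ∀ t, B t w = Nᶜ.indicator (B t) w := by
    filter_upwards [compl_mem_ae_iff.2 hN0] with w hw t
    rw [Set.indicator_of_mem hw]
  refine ⟨fun t => Nᶜ.indicator (B t),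
    hB.congr (fun t => (hB.measurable t).indicator hNm.compl) hae, fun w => ?_, hae⟩
  by_cases hw : w ∈ N
  · simpa [hw] using continuous_const
  · simpa [hw] using not_not.1 fun h => hw (hN h)

lemma measurable_pathIntegral {V : E3 → ℝ} (hV : Continuous V) (θ : E3)
    (hc : ∀ w, Continuous fun t => B t w) (hm : ∀ t, Measurable (B t)) :
    Measurable (pathIntegral V (driftedPath θ B)) :=
  measurable_lintegral_Ioi hV θ hc 0 fun t _ => hm t

lemma expectedDamping_congr {C : ℝ≥0 → Ω → E3} (V : E3 → ℝ) (θ : E3)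
    (h : ∀ᵐ w ∂P, ∀ t, B t w = C t w) :
    expectedDamping V (driftedPath θ B) P = expectedDamping V (driftedPath θ C) P :=
  lintegral_congr_ae <| by
    filter_upwards [h] with w hw using by simp only [pathIntegral_congr V θ hw]

end Brownian

/-! ### Convergence of the expected damping -/

theorem lemma1p2 {Ω : Type*} [MeasurableSpace Ω] (P : Measure Ω) [IsProbabilityMeasure P]
    (B : ℝ≥0 → Ω → E3) (hB : IsBrownianMotion3 B P)
    (V : E3 → ℝ) (hV : Continuous V)
    (χ : ℝ → ℝ → ℝ) (hχ : ∀ R : ℝ, 0 < R → IsRadialCutoff R (χ R))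
    (θ : E3) (hθ : ‖θ‖ = 1)
    (hpos : 0 < expectedDamping V (driftedPath θ B) P) :
    Tendsto (fun ρ : ℝ => expectedDamping (tailPotential V (χ ρ)) (driftedPath θ B) P)
      atTop (𝓝 1) := by
  obtain ⟨C, hC, hc, hBC⟩ := hB.exists_continuous_version
  simp_rw [expectedDamping_congr _ θ hBC] at hpos ⊢
  have hfin : ∀ᵐ w ∂P, pathIntegral V (driftedPath θ C) w < ⊤ := by
    have hmeas : Measurable (pathIntegral V (driftedPath θ C)) :=
      measurable_pathIntegral hV θ hc hC.measurable
    rcases hC.measure_eq_zero_or_one_of_tail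
      (measurableSet_tail_pathIntegral_lt_top hV θ hc) with h | h
    -- If the path integral were infinite almost surely, the damping factor would vanish.
    · refine absurd ?_ hpos.ne'
      refine (lintegral_congr_ae ?_).trans lintegral_zero
      filter_upwards [measure_eq_zero_iff_ae_notMem.1 h] with w hw
      have hw' : pathIntegral V (driftedPath θ C) w = ⊤ := top_le_iff.1 (not_lt.1 hw)
      simp [hw', ENNReal.top_div]
    · exact (prob_compl_eq_zero_iff (measurableSet_lt hmeas measurable_const)).2 h
  rw [show (1 : ℝ≥0∞) = ∫⁻ _, 1 ∂P by simp]
  refine tendsto_lintegral_filter_of_dominated_convergence (fun _ => 1) ?_ ?_ (by simp) ?_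
  · filter_upwards [eventually_gt_atTop 0] with ρ hρ
    exact continuous_exp_neg_half.measurable.comp (measurable_pathIntegral
      (continuous_tailPotential hV (hχ ρ hρ)) θ hc hC.measurable)
  · refine Eventually.of_forall fun ρ => ae_of_all _ fun w => ?_
    have := EReal.exp_monotone (EReal.neg_le_neg_iff.2 (EReal.coe_ennreal_nonneg
      (pathIntegral (tailPotential V (χ ρ)) (driftedPath θ C) w / 2)))
    simpa using this
  · filter_upwards [hfin] with w hw
    have := (continuous_exp_neg_half.tendsto 0).comp
      (tendsto_pathIntegral_tailPotential hV hχ θ (hc w) hw)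
    simpa [Function.comp_def] using this
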